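/- Let $k\ge 1$ be an integer, let $p=2k^2+2k+1$, and let $m,n$ be integers with $m,n>2p$. Identify the $m\times n$ grid graph with $G_{m,n}=\{(i,j)\in\mathbb Z^2: 0\le i\le m-1,\ 0\le j\le n-1\}$, and put $Y_{m+2k,n+2k}=\{(i,j)\in\mathbb Z^2: -k\le i\le m+k-1,\ -k\le j\le n+k-1\}$. Let $\phi_k:\mathbb Z^2\to\mathbb Z/p\mathbb Z$ be the homomorphism $(i,j)\mapsto (k+1)i+kj$. A set $T\subseteq\mathbb Z^2$ is said to $k$-distance dominate $G_{m,n}$ if every vertex of $G_{m,n}$ is at distance at most $k$ from some element of $T$, where distance is the graph distance in the integer lattice $\mathbb Z^2$. By the four corners of $Y_{m+2k,n+2k}$ we mean the four $p\times p$ squares of lattice points at its corners. Then for every $\bar\ell\in\mathbb Z/p\mathbb Z$ one vertex can be removed from each of the four corners of $S=\phi_k^{-1}(\bar\ell)\cap Y_{m+2k,n+2k}$, after local shifts of nearby vertices, so that the resulting set still $k$-distance dominates $G_{m,n}$. Precisely: there are four distinct vertices of $S$, one in each of the four corners, and a map $\sigma:\mathbb Z^2\to\mathbb Z^2$ which changes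 each coordinate of each point by at most $1$ and fixes every point outside the four corners, such that the image under $\sigma$ of $S$ with these four vertices removed $k$-distance dominates $G_{m,n}$. -/

import Mathlib

namespace GridDomination

/-- `p = 2k² + 2k + 1`, the number of lattice points at distance at most `k` from a given one. -/
def p (k : ℕ) : ℕ := 2 * k ^ 2 + 2 * k + 1

/-- The integer lattice graph on `ℤ²`: two points are adjacent when they agree in one coordinate
and differ by exactly one in the other. -/
noncomputable def latticeGraph : SimpleGraph (ℤ × ℤ) :=
  SimpleGraph.boxProd (SimpleGraph.hasse ℤ) (SimpleGraph.hasse ℤ)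

/-- Every point of `A` is within graph distance `k` (in `ℤ²`) of some point of `T`. -/
def DistDominates (k : ℕ) (T A : Set (ℤ × ℤ)) : Prop :=
  ∀ v ∈ A, ∃ w ∈ T, latticeGraph.edist v w ≤ (k : ℕ∞)

/-- The vertices of the `m × n` grid graph `G_{m,n}`, embedded in `ℤ²`. -/
def gridSet (m n : ℕ) : Set (ℤ × ℤ) :=
  {v | 0 ≤ v.1 ∧ v.1 ≤ (m : ℤ) - 1 ∧ 0 ≤ v.2 ∧ v.2 ≤ (n : ℤ) - 1}

/-- The neighbourhood `Y_{m+2k,n+2k}` of `G_{m,n}`: `k` rows and columns are added on each side. -/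
def nbhd (k m n : ℕ) : Set (ℤ × ℤ) :=
  {v | -(k : ℤ) ≤ v.1 ∧ v.1 ≤ (m : ℤ) + k - 1 ∧ -(k : ℤ) ≤ v.2 ∧ v.2 ≤ (n : ℤ) + k - 1}

/-- The homomorphism `φ_k : ℤ² → ℤ/p`, `(i, j) ↦ (k+1) i + k j`. -/
def phi (k : ℕ) : ℤ × ℤ →+ ZMod (p k) where
  toFun v := ((((k : ℤ) + 1) * v.1 + (k : ℤ) * v.2 : ℤ) : ZMod (p k))
  map_zero' := by simp
  map_add' v w := by
    simp only [Prod.fst_add, Prod.snd_add]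
    push_cast
    ring

/-- The set `φ_k⁻¹(ℓ) ∩ Y_{m+2k,n+2k}`. -/
def domSet (k m n : ℕ) (l : ZMod (p k)) : Set (ℤ × ℤ) :=
  (phi k) ⁻¹' {l} ∩ nbhd k m n

/-- The four corners of the rectangle. -/
inductive Corner where
  | southwest
  | southeast
  | northwest
  | northeast

/-- The `p × p` square of lattice points sitting in the given corner of `Y_{m+2k,n+2k}`
(first coordinate increasing to the east, second coordinate increasing to the north). -/
def cornerSquare (k m n : ℕ) : Corner → Set (ℤ × ℤ)
  | .southwest => {v | v ∈ nbhd k m n ∧ v.1 < -(k : ℤ) + p k ∧ v.2 < -(k : ℤ) + p k}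
  | .southeast => {v | v ∈ nbhd k m n ∧ (m : ℤ) + k - p k ≤ v.1 ∧ v.2 < -(k : ℤ) + p k}
  | .northwest => {v | v ∈ nbhd k m n ∧ v.1 < -(k : ℤ) + p k ∧ (n : ℤ) + k - p k ≤ v.2}
  | .northeast => {v | v ∈ nbhd k m n ∧ (m : ℤ) + k - p k ≤ v.1 ∧ (n : ℤ) + k - p k ≤ v.2}

end GridDomination

/-!
The idea. Put `h (i, j) = (k + 1) i + k j`, so that the set `φ⁻¹(ℓ)` is the set of lattice points
on which `h` takes a given value modulo `p = 2k² + 2k + 1`. The `ℓ¹`-balls of radius `k` ("diamonds")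
around these code points cover the lattice (`exists_code_inDiamond`), so before any change each grid
vertex is covered. A quarter turn multiplies `h` modulo `p` by a square root of `-1`, so the code is
preserved up to translation, and it is enough to treat the corner at the origin, where the grid is
the first quadrant (`exists_removable_corner`).

There, remove a code point `s` on an outermost edge of the neighbourhood, whose diamond meets the
quadrant in at most one vertex, and shift all code points of the half-plane `h ≤ h s` by one step
towards its boundary. A shifted half-plane leaves no gap behind it where it has another code point
to follow: whatever a tile uncovers is taken over by one of two neighbouring tiles of the
half-plane. Gaps can only come from neighbours lying just outside the neighbourhood. For `s = (-k, b)`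
on the western edge with an upward shift (`removable_west`) such a neighbour is
`(x, 0) + (k, -(k + 1))`, where `(x, 0)` is a code point of the half-plane. The gap for `x = -k` or
`x = 0` can be filled by moving one further code point, and there is none for `-k < x < 0`, where
`(x, 0)` itself moves right instead of up. If there
is such an `(x, 0)` with `x ≥ 1`, then `(x - k - 1, -k)` is removed instead and the half-plane below
it is shifted to the right (`removable_south`): the gaps of that shift would come from code points
`(0, y)`, and none of these lies in the half-plane, because it would differ from `(0, b - k - 1)` by
a nonzero multiple of `p`, which does not fit in the corner.
-/

namespace GridDomination

/-! ### Diamonds in the integer lattice -/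

/-- `v` lies in the `ℓ¹`-ball of radius `k` around `c`, written as an intersection of four
half-planes so that membership is a linear condition. -/
def InDiamond (k : ℤ) (c v : ℤ × ℤ) : Prop :=
  (v.1 - c.1) + (v.2 - c.2) ≤ k ∧ (v.1 - c.1) - (v.2 - c.2) ≤ k ∧
    -(v.1 - c.1) + (v.2 - c.2) ≤ k ∧ -(v.1 - c.1) - (v.2 - c.2) ≤ k

lemma edist_hasse_int_add_natCast_le (a : ℤ) (n : ℕ) :
    (SimpleGraph.hasse ℤ).edist a (a + n) ≤ n := by
  induction n with
  | zero => simp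
  | succ n ih =>
    have h1 : (SimpleGraph.hasse ℤ).edist (a + n) (a + (n + 1 : ℕ)) = 1 := by
      rw [SimpleGraph.edist_eq_one_iff_adj, SimpleGraph.hasse_adj]
      left
      rw [Order.covBy_iff_add_one_eq]
      push_cast
      ring
    calc (SimpleGraph.hasse ℤ).edist a (a + (n + 1 : ℕ))
        ≤ (SimpleGraph.hasse ℤ).edist a (a + n)
          + (SimpleGraph.hasse ℤ).edist (a + n) (a + (n + 1 : ℕ)) :=
          SimpleGraph.edist_triangle
      _ ≤ n + 1 := by rw [h1]; gcongr
      _ = ((n + 1 : ℕ) : ℕ∞) := by push_cast; rfl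

lemma edist_hasse_int_le (a b : ℤ) :
    (SimpleGraph.hasse ℤ).edist a b ≤ ((a - b).natAbs : ℕ∞) := by
  rcases le_total a b with h | h
  · have := edist_hasse_int_add_natCast_le a (a - b).natAbs
    rwa [show a + ((a - b).natAbs : ℤ) = b by omega] at this
  · have := edist_hasse_int_add_natCast_le b (a - b).natAbs
    rwa [show b + ((a - b).natAbs : ℤ) = a by omega, SimpleGraph.edist_comm] at this

lemma InDiamond.edist_le {k : ℕ} {c v : ℤ × ℤ} (h : InDiamond k c v) :
    latticeGraph.edist v c ≤ (k : ℕ∞) := by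
  obtain ⟨h1, h2, h3, h4⟩ := h
  rw [latticeGraph, SimpleGraph.edist_boxProd]
  calc _ ≤ ((v.1 - c.1).natAbs : ℕ∞) + ((v.2 - c.2).natAbs : ℕ∞) :=
        add_le_add (edist_hasse_int_le _ _) (edist_hasse_int_le _ _)
    _ = (((v.1 - c.1).natAbs + (v.2 - c.2).natAbs : ℕ) : ℕ∞) := by push_cast; rfl
    _ ≤ k := by exact_mod_cast (by omega)

/-! ### The perfect code -/

/-- The integer linear form whose reduction modulo `p k` is `phi k`. -/
def form (k : ℤ) (v : ℤ × ℤ) : ℤ := (k + 1) * v.1 + k * v.2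

/-- The integer `2k² + 2k + 1`. -/
def modulus (k : ℤ) : ℤ := 2 * k ^ 2 + 2 * k + 1

/-- The fibre of `form k` over the residue class of `L` modulo `2k² + 2k + 1`. -/
def code (k L : ℤ) : Set (ℤ × ℤ) := {c | modulus k ∣ form k c - L}

lemma natCast_p (k : ℕ) : (p k : ℤ) = modulus k := by
  simp [p, modulus]

lemma phi_eq_intCast_iff (k : ℕ) (L : ℤ) (v : ℤ × ℤ) :
    phi k v = (L : ZMod (p k)) ↔ v ∈ code k L := by
  rw [code, Set.mem_ofPred_eq, ← natCast_p, ← ZMod.intCast_zmod_eq_zero_iff_dvd, Int.cast_sub,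
    sub_eq_zero]
  rfl

/-- Translating by a vector whose form is a multiple of the modulus preserves the code. -/
lemma code_of_form_eq {k L : ℤ} {c d : ℤ × ℤ} (t : ℤ) (h : form k d = form k c + t * modulus k)
    (hc : c ∈ code k L) : d ∈ code k L := by
  obtain ⟨r, hr⟩ := hc
  exact ⟨r + t, by rw [h]; linear_combination hr⟩

/-- The diamonds around the code points cover the lattice. The vector from the centre is found from
the balanced residue `r` of the form: a balanced division `2 r = (2 k + 1) A + B` gives the
coordinates `(A + B) / 2` and `(A - B) / 2`. -/
lemma exists_code_inDiamond {k : ℤ} (hk : 1 ≤ k) (L : ℤ) (v : ℤ × ℤ) :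
    ∃ c ∈ code k L, InDiamond k c v := by
  have hP : 0 < modulus k := by unfold modulus; positivity
  have hP2 : modulus k = 2 * (k * k + k) + 1 := by unfold modulus; ring
  set z := form k v - L + (k * k + k) with hz
  set r := z % modulus k - (k * k + k) with hr
  have hr1 : -(k * k + k) ≤ r := by have := Int.emod_nonneg z hP.ne'; omega
  have hr2 : r ≤ k * k + k := by have := Int.emod_lt_of_pos z hP; omega
  set A := (2 * r + k) / (2 * k + 1) with hA
  have hdiv := Int.mul_ediv_add_emod (2 * r + k) (2 * k + 1)
  have hm1 := Int.emod_nonneg (2 * r + k) (show 2 * k + 1 ≠ 0 by omega)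
  have hm2 := Int.emod_lt_of_pos (2 * r + k) (show 0 < 2 * k + 1 by omega)
  rw [← hA] at hdiv
  obtain ⟨B, hB⟩ : ∃ B, B = 2 * r - (2 * k + 1) * A := ⟨_, rfl⟩
  have hB1 : -k ≤ B := by linarith
  have hB2 : B ≤ k := by linarith
  have hA1 : A ≤ k := by by_contra! h; nlinarith
  have hA2 : -k ≤ A := by by_contra! h; nlinarith
  have hpar : B = 2 * (r - k * A) - A := by rw [hB]; ring
  obtain ⟨i, hi⟩ : ∃ i, i = r - k * A := ⟨_, rfl⟩
  refine ⟨(v.1 - i, v.2 - (A - i)), ⟨z / modulus k, ?_⟩, ?_⟩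
  · have h1 := Int.mul_ediv_add_emod z (modulus k)
    have h2 : form k (v.1 - i, v.2 - (A - i)) = form k v - r := by
      simp only [form]
      linear_combination (-1 : ℤ) * hi
    rw [h2]
    linarith
  · simp only [InDiamond]
    omega

end GridDomination

namespace GridDomination

/-! ### Removing a vertex near the south-west corner -/

/-- The `p × p` square at the south-west corner of the neighbourhood, where the grid graph is the
first quadrant. -/
def InSquare (k : ℤ) (c : ℤ × ℤ) : Prop :=
  -k ≤ c.1 ∧ c.1 < -k + modulus k ∧ -k ≤ c.2 ∧ c.2 < -k + modulus k

/-- The shift used when the removed vertex lies on the western edge. Points in the half-plane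
`form ≤ H` move up; those west of the quadrant move right instead, which covers at least as much of
the quadrant. Beyond the half-plane, the points just below the quadrant move diagonally, which loses
nothing in the quadrant. -/
def shiftUp (k H : ℤ) (c : ℤ × ℤ) : ℤ × ℤ :=
  if form k c ≤ H then (if c.1 < 0 then (c.1 + 1, c.2) else (c.1, c.2 + 1))
  else if c.2 = -1 then (c.1 - 1, c.2 + 1) else c

/-- The shift used when the removed vertex lies on the southern edge. Points in the half-plane
`form ≤ H` move right; those south of the quadrant move up instead, which covers at least as much of
the quadrant. -/
def shiftRight (k H : ℤ) (c : ℤ × ℤ) : ℤ × ℤ :=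
  if form k c ≤ H then (if c.2 < 0 then (c.1, c.2 + 1) else (c.1 + 1, c.2)) else c

lemma shiftUp_near (k H : ℤ) (c : ℤ × ℤ) :
    |(shiftUp k H c).1 - c.1| ≤ 1 ∧ |(shiftUp k H c).2 - c.2| ≤ 1 := by
  unfold shiftUp
  split_ifs <;> simp

lemma shiftRight_near (k H : ℤ) (c : ℤ × ℤ) :
    |(shiftRight k H c).1 - c.1| ≤ 1 ∧ |(shiftRight k H c).2 - c.2| ≤ 1 := by
  unfold shiftRight
  split_ifs <;> simp

lemma InDiamond.shiftUp_of_lt {k H : ℤ} {c v : ℤ × ℤ} (hv2 : 0 ≤ v.2) (hH : H < form k c)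
    (h : InDiamond k c v) : InDiamond k (shiftUp k H c) v := by
  unfold shiftUp
  simp only [InDiamond] at h
  split_ifs <;> simp only [InDiamond] <;> omega

lemma InDiamond.shiftUp_of_le {k H : ℤ} {c v : ℤ × ℤ} (hv1 : 0 ≤ v.1) (hH : form k c ≤ H)
    (h : InDiamond k (c.1, c.2 + 1) v) : InDiamond k (shiftUp k H c) v := by
  unfold shiftUp
  simp only [InDiamond] at h
  split_ifs <;> simp only [InDiamond] <;> omega

lemma InDiamond.shiftRight_of_le {k H : ℤ} {c v : ℤ × ℤ} (hv2 : 0 ≤ v.2) (hH : form k c ≤ H)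
    (h : InDiamond k (c.1 + 1, c.2) v) : InDiamond k (shiftRight k H c) v := by
  unfold shiftRight
  simp only [InDiamond] at h
  split_ifs <;> simp only [InDiamond] <;> omega

/-- `s` can be removed from the code, after applying `σ`, without uncovering a point of the first
quadrant: whatever a code point of the corner square covered is covered by a shifted one. -/
def Removable (k L : ℤ) (s : ℤ × ℤ) (σ : ℤ × ℤ → ℤ × ℤ) : Prop :=
  ∀ v : ℤ × ℤ, 0 ≤ v.1 → 0 ≤ v.2 → ∀ c ∈ code k L, InSquare k c → InDiamond k c v →
    ∃ c' ∈ code k L, InSquare k c' ∧ c' ≠ s ∧ InDiamond k (σ c') v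

/-- A vertex `(-k, b)` on the western edge is removable by `shiftUp` unless some code point `(x, 0)`
with `x ≥ 1` lies in the half-plane below `(-k, b)`. A point
lost by `c` is taken over by the neighbouring tile `c - (k + 1, k)` or `c + (k, -(k + 1))`, and, when
the latter has left the neighbourhood, by the diagonally shifted `c + (2k + 1, -1)`. -/
lemma removable_west {k L b : ℤ} (hk : 1 ≤ k) (hs : (-k, b) ∈ code k L)
    (hsq : InSquare k (-k, b))
    (hfree : ∀ x, (x, 0) ∈ code k L → 1 ≤ x → form k (-k, b) < form k (x, 0)) :
    Removable k L (-k, b) (shiftUp k (form k (-k, b))) := by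
  intro v hv1 hv2 c hc hcS hcv
  have hP : modulus k = 2 * k ^ 2 + 2 * k + 1 := rfl
  obtain ⟨H, hH⟩ : ∃ H, H = form k (-k, b) := ⟨_, rfl⟩
  rw [← hH] at hfree ⊢
  simp only [InSquare] at hsq
  obtain ⟨hc1, hc2, hc3, hc4⟩ := hcS
  rcases lt_or_ge H (form k c) with hlt | hle
  · refine ⟨c, hc, ⟨hc1, hc2, hc3, hc4⟩, ?_, hcv.shiftUp_of_lt hv2 hlt⟩
    rintro rfl
    omega
  by_cases hdone : c ≠ (-k, b) ∧ InDiamond k (shiftUp k H c) v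
  · exact ⟨c, hc, ⟨hc1, hc2, hc3, hc4⟩, hdone.1, hdone.2⟩
  -- Otherwise `v` is on the lower boundary of the diamond of `c`.
  have hlost : v.2 ≤ c.2 ∧ (v.1 - c.1 - (v.2 - c.2) = k ∨ -(v.1 - c.1) - (v.2 - c.2) = k) ∧
      (c.1 < 0 → c = (-k, b)) := by
    by_cases hcs : c = (-k, b)
    · subst hcs
      simp only [InDiamond] at hcv ⊢
      exact ⟨by omega, by omega, by simp⟩
    · have hnot : ¬ InDiamond k (shiftUp k H c) v := fun h => hdone ⟨hcs, h⟩
      unfold shiftUp at hnot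
      simp only [InDiamond, if_pos hle] at hnot hcv
      split_ifs at hnot <;> (simp only at hnot; omega)
  obtain ⟨hl1, hl2, hl3⟩ := hlost
  rcases lt_or_ge v.1 c.1 with hi | hi
  · have hform : form k (c.1 - (k + 1), c.2 - k) = form k c - modulus k := by
      simp only [form, modulus]; ring
    have hPpos : 0 < modulus k := by rw [hP]; positivity
    refine ⟨(c.1 - (k + 1), c.2 - k), code_of_form_eq (-1) (by rw [hform]; ring) hc, ?_, ?_,
      InDiamond.shiftUp_of_le hv1 (by omega) ?_⟩
    · simp only [InSquare]; simp only [InDiamond] at hcv; omega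
    · intro h
      rw [h, ← hH] at hform
      omega
    · simp only [InDiamond] at hcv ⊢; omega
  · have hform : form k (c.1 + k, c.2 - (k + 1)) = form k c := by
      simp only [form]; ring
    by_cases hin : 0 < c.2
    · refine ⟨(c.1 + k, c.2 - (k + 1)), code_of_form_eq 0 (by rw [hform]; ring) hc, ?_, ?_,
        InDiamond.shiftUp_of_le hv1 (by omega) ?_⟩
      · have hx : c.1 + k < -k + modulus k := by
          have h1 : (k + 1) * c.1 + k * c.2 ≤ (k + 1) * (-k) + k * b := by
            rw [hH] at hle; exact hle
          by_contra! h
          nlinarith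
        simp only [InSquare]; omega
      · intro h
        have := congrArg Prod.fst h
        simp only at this
        omega
      · simp only [InDiamond] at hcv ⊢; omega
    · -- Here `v = (c.1 + k, 0)`, and the tile that should take over lies just outside.
      have hc20 : c.2 = 0 := by omega
      have hform3 : form k (c.1 + (2 * k + 1), c.2 - 1) = form k c + modulus k := by
        simp only [form, modulus]; ring
      -- The point `c` is either the removed vertex or the origin, so it lies on the line `form = H`.
      have hcH : c.1 ≤ 0 ∧ form k c = H := by
        by_cases hneg : c.1 < 0
        · exact ⟨hneg.le, by rw [hl3 hneg, hH]⟩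
        · have hc0 : c = (0, 0) := by
            have hce : c = (c.1, 0) := Prod.ext rfl hc20
            have : ¬ 1 ≤ c.1 := fun h => by
              have := hfree c.1 (hce ▸ hc) h
              rw [← hce] at this
              omega
            ext <;> simp only <;> omega
          subst hc0
          refine ⟨le_rfl, ?_⟩
          have h1 : modulus k ∣ k * (b - (k + 1)) := by
            have h : modulus k ∣ (form k (-k, b) - L) - (form k (0, 0) - L) := dvd_sub hs hc
            rwa [show (form k (-k, b) - L) - (form k (0, 0) - L) = k * (b - (k + 1)) by
              simp only [form]; ring] at h
          have h2 : IsCoprime (modulus k) k := ⟨1, -(2 * k + 2), by rw [hP]; ring⟩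
          have h3 := h2.dvd_of_dvd_mul_left h1
          have h4 : 0 ≤ k * (b - (k + 1)) := by
            simp only [form] at hH hle; linarith
          have h5 : 0 ≤ b - (k + 1) := nonneg_of_mul_nonneg_right h4 (by omega)
          have h6 := Int.eq_zero_of_dvd_of_nonneg_of_lt h5 (by omega) h3
          have hb : b = k + 1 := by omega
          rw [hH, hb]
          simp only [form]; ring
      have hPpos : 0 < modulus k := by rw [hP]; positivity
      have hbound : 3 * k + 1 < modulus k := by rw [hP]; nlinarith
      refine ⟨(c.1 + (2 * k + 1), c.2 - 1), code_of_form_eq 1 (by rw [hform3]; ring) hc, ?_, ?_, ?_⟩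
      · simp only [InSquare]; omega
      · intro h
        have := congrArg Prod.fst h
        simp only at this
        omega
      · unfold shiftUp
        rw [if_neg (by rw [hform3]; omega), if_pos (by simp only; omega)]
        simp only [InDiamond] at hcv ⊢; omega

/-- When a code point `(x, 0)` obstructs `removable_west`, the vertex `(x - k - 1, -k)` on the southern edge is removable by `shiftRight`.
A point lost by `c` is taken over by the neighbouring tile `c + (-k, k + 1)` or `c - (k + 1, k)`. -/
lemma removable_south {k L b x : ℤ} (hk : 1 ≤ k) (hs : (-k, b) ∈ code k L)
    (hsq : InSquare k (-k, b)) (hx : (x, 0) ∈ code k L) (hx1 : 1 ≤ x)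
    (hle : form k (x, 0) ≤ form k (-k, b)) :
    (x - (k + 1), -k) ∈ code k L ∧ InSquare k (x - (k + 1), -k) ∧
      Removable k L (x - (k + 1), -k) (shiftRight k (form k (x - (k + 1), -k))) := by
  have hP : modulus k = 2 * k ^ 2 + 2 * k + 1 := rfl
  have hPpos : 0 < modulus k := by rw [hP]; positivity
  obtain ⟨H, hH⟩ : ∃ H, H = form k (x - (k + 1), -k) := ⟨_, rfl⟩
  have hHx : H = (k + 1) * x - modulus k := by rw [hH, hP]; simp only [form]; ring
  have hxb : (k + 1) * x ≤ k * b - k * (k + 1) := by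
    simp only [form] at hle; linarith
  simp only [InSquare] at hsq
  have hxlt : x < modulus k - k := by by_contra! h; nlinarith
  refine ⟨code_of_form_eq (-1) (by simp only [form, modulus]; ring) hx,
    by simp only [InSquare]; omega, ?_⟩
  rw [← hH]
  -- The western edge of the quadrant is unobstructed: such a point `(0, y)` would lie below
  -- `(0, b - (k + 1))`, which is also a code point, by a positive multiple of the modulus.
  have hfree : ∀ y, (0, y) ∈ code k L → 0 ≤ y → H < form k (0, y) := by
    intro y hy hy0
    by_contra! hcon
    simp only [form] at hcon
    have h1 : modulus k ∣ k * (b - (k + 1) - y) := by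
      have h : modulus k ∣ (form k (-k, b) - L) - (form k (0, y) - L) := dvd_sub hs hy
      rwa [show (form k (-k, b) - L) - (form k (0, y) - L) = k * (b - (k + 1) - y) by
        simp only [form]; ring] at h
    have h2 : IsCoprime (modulus k) k := ⟨1, -(2 * k + 2), by rw [hP]; ring⟩
    have h3 := h2.dvd_of_dvd_mul_left h1
    have h4 : 0 < k * (b - (k + 1) - y) := by nlinarith
    have h5 : 0 < b - (k + 1) - y := pos_of_mul_pos_right h4 (by omega)
    have h6 := Int.le_of_dvd h5 h3
    omega
  -- The half-plane `form ≤ H` meets the neighbourhood inside the corner square.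
  have hbd : ∀ c : ℤ × ℤ, form k c ≤ H → -k ≤ c.1 → -k ≤ c.2 → InSquare k c := by
    intro c hc h1 h2
    simp only [form] at hc
    have h3 : c.2 < -k + modulus k := by by_contra! h; nlinarith
    have h4 : c.1 < -k + modulus k := by by_contra! h; nlinarith
    exact ⟨h1, h4, h2, h3⟩
  intro v hv1 hv2 c hc hcS hcv
  rcases lt_or_ge H (form k c) with hlt | hcle
  · refine ⟨c, hc, hcS, ?_, ?_⟩
    · rintro rfl
      omega
    · unfold shiftRight
      rwa [if_neg (by omega)]
  by_cases hdone : c ≠ (x - (k + 1), -k) ∧ InDiamond k (shiftRight k H c) v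
  · exact ⟨c, hc, hcS, hdone.1, hdone.2⟩
  obtain ⟨hc1, hc2, hc3, hc4⟩ := hcS
  -- Otherwise `v` is on the left boundary of the diamond of `c`.
  have hlost : v.1 ≤ c.1 ∧ (-(v.1 - c.1) + (v.2 - c.2) = k ∨ -(v.1 - c.1) - (v.2 - c.2) = k) ∧
      (c.2 < 0 → v.2 = c.2 + k) := by
    by_cases hcs : c = (x - (k + 1), -k)
    · subst hcs
      simp only [InDiamond] at hcv ⊢
      omega
    · have hnot : ¬ InDiamond k (shiftRight k H c) v := fun h => hdone ⟨hcs, h⟩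
      unfold shiftRight at hnot
      simp only [InDiamond, if_pos hcle] at hnot hcv
      split_ifs at hnot <;> omega
  obtain ⟨hl1, hl2, hl3⟩ := hlost
  rcases lt_or_ge c.2 v.2 with hj | hj
  · have hform : form k (c.1 - k, c.2 + (k + 1)) = form k c := by
      simp only [form]; ring
    refine ⟨(c.1 - k, c.2 + (k + 1)), code_of_form_eq 0 (by rw [hform]; ring) hc,
      hbd _ (by omega) ?_ ?_, ?_, InDiamond.shiftRight_of_le hv2 (by omega) ?_⟩
    · simp only; omega
    · simp only; omega
    · intro h
      have := congrArg Prod.snd h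
      simp only at this
      omega
    · simp only [InDiamond] at hcv ⊢; omega
  · have hform : form k (c.1 - (k + 1), c.2 - k) = form k c - modulus k := by
      simp only [form, modulus]; ring
    have hc1pos : 0 < c.1 := by
      by_contra! h
      have hc0 : c = (0, c.2) := Prod.ext (by simp only; omega) rfl
      have := hfree c.2 (hc0 ▸ hc) (by omega)
      rw [← hc0] at this
      omega
    refine ⟨(c.1 - (k + 1), c.2 - k), code_of_form_eq (-1) (by rw [hform]; ring) hc,
      hbd _ (by omega) ?_ ?_, ?_, InDiamond.shiftRight_of_le hv2 (by omega) ?_⟩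
    · simp only; omega
    · simp only; omega
    · intro h
      rw [h, ← hH] at hform
      omega
    · simp only [InDiamond] at hcv ⊢; omega

/-- Every column of the corner square contains a code point; this is the case of the
westernmost column. -/
lemma exists_code_west {k : ℤ} (hk : 1 ≤ k) (L : ℤ) :
    ∃ b, (-k, b) ∈ code k L ∧ InSquare k (-k, b) := by
  have hP : modulus k = 2 * k ^ 2 + 2 * k + 1 := rfl
  have hPpos : 0 < modulus k := by rw [hP]; positivity
  -- `-(2k + 2)` is the inverse of `k` modulo `2k² + 2k + 1`.
  set z := -(2 * k + 2) * (L + k * (k + 1)) + k with hz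
  have h1 := Int.mul_ediv_add_emod z (modulus k)
  have h2 := Int.emod_nonneg z hPpos.ne'
  have h3 := Int.emod_lt_of_pos z hPpos
  refine ⟨z % modulus k - k, ⟨-(L + k * (k + 1)) - k * (z / modulus k), ?_⟩, ?_⟩
  · have h4 : z % modulus k = z - modulus k * (z / modulus k) := by linarith
    simp only [form, h4]
    rw [hz, hP]
    ring
  · simp only [InSquare]; omega

theorem exists_removable {k : ℤ} (hk : 1 ≤ k) (L : ℤ) :
    ∃ s ∈ code k L, InSquare k s ∧ ∃ σ : ℤ × ℤ → ℤ × ℤ,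
      (∀ v, |(σ v).1 - v.1| ≤ 1 ∧ |(σ v).2 - v.2| ≤ 1) ∧ Removable k L s σ := by
  obtain ⟨b, hb, hbS⟩ := exists_code_west hk L
  by_cases hex : ∃ x, (x, 0) ∈ code k L ∧ 1 ≤ x ∧ form k (x, 0) ≤ form k (-k, b)
  · obtain ⟨x, hx, hx1, hle⟩ := hex
    obtain ⟨h1, h2, h3⟩ := removable_south hk hb hbS hx hx1 hle
    exact ⟨_, h1, h2, _, shiftRight_near k _, h3⟩
  · push Not at hex
    exact ⟨_, hb, hbS, _, shiftUp_near k _, removable_west hk hb hbS hex⟩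

end GridDomination

namespace GridDomination

/-! ### Transport to the four corners -/

/-- The rotation of the lattice that carries the given corner of the `m × n` grid graph to the
origin and the grid graph into the first quadrant. Rotations (rather than reflections) are used
because only they respect the code. -/
def cornerFrame (m n : ℤ) : Corner → (ℤ × ℤ ≃ ℤ × ℤ)
  | .southwest => Equiv.refl _
  | .southeast =>
    { toFun := fun v => (v.2, m - 1 - v.1)
      invFun := fun w => (m - 1 - w.2, w.1)
      left_inv := fun v => by simp
      right_inv := fun w => by simp }
  | .northwest =>
    { toFun := fun v => (n - 1 - v.2, v.1)
      invFun := fun w => (w.2, n - 1 - w.1)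
      left_inv := fun v => by simp
      right_inv := fun w => by simp }
  | .northeast =>
    { toFun := fun v => (m - 1 - v.1, n - 1 - v.2)
      invFun := fun w => (m - 1 - w.1, n - 1 - w.2)
      left_inv := fun v => by simp
      right_inv := fun w => by simp }

lemma inDiamond_cornerFrame (m n : ℤ) (C : Corner) (k : ℤ) (c v : ℤ × ℤ) :
    InDiamond k (cornerFrame m n C c) (cornerFrame m n C v) ↔ InDiamond k c v := by
  cases C <;> simp only [cornerFrame, InDiamond, Equiv.coe_fn_mk, Equiv.refl_apply] <;> omega

lemma abs_sub_le_of_cornerFrame (m n : ℤ) (C : Corner) (u v : ℤ × ℤ)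
    (h : |(cornerFrame m n C u).1 - (cornerFrame m n C v).1| ≤ 1 ∧
      |(cornerFrame m n C u).2 - (cornerFrame m n C v).2| ≤ 1) :
    |u.1 - v.1| ≤ 1 ∧ |u.2 - v.2| ≤ 1 := by
  simp only [abs_le] at h ⊢
  cases C <;> simp only [cornerFrame, Equiv.coe_fn_mk, Equiv.refl_apply] at h <;> omega

lemma cornerFrame_nonneg {m n : ℕ} {v : ℤ × ℤ} (hv : v ∈ gridSet m n) (C : Corner) :
    0 ≤ (cornerFrame m n C v).1 ∧ 0 ≤ (cornerFrame m n C v).2 := by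
  obtain ⟨h1, h2, h3, h4⟩ := hv
  cases C <;> simp only [cornerFrame, Equiv.coe_fn_mk, Equiv.refl_apply] <;> omega

lemma mem_cornerSquare_iff {k m n : ℕ} (hm : 2 * p k < m) (hn : 2 * p k < n) (C : Corner)
    (v : ℤ × ℤ) : v ∈ cornerSquare k m n C ↔ InSquare k (cornerFrame m n C v) := by
  have h := natCast_p k
  cases C <;> simp only [cornerFrame, Equiv.coe_fn_mk, Equiv.refl_apply, cornerSquare, nbhd,
    InSquare, Set.mem_ofPred_eq, ← h] <;> omega

lemma corner_eq_of_mem_cornerSquare {k m n : ℕ} (hm : 2 * p k < m) (hn : 2 * p k < n)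
    {C D : Corner} {v : ℤ × ℤ} (hC : v ∈ cornerSquare k m n C) (hD : v ∈ cornerSquare k m n D) :
    C = D := by
  cases C <;> cases D <;> simp only [cornerSquare, nbhd, Set.mem_ofPred_eq] at hC hD <;>
    first | rfl | omega

lemma mem_code_iff_of_form {k L a b q : ℤ} {v w : ℤ × ℤ} (ha : IsCoprime (modulus k) a)
    (h : form k w = a * form k v + b + modulus k * q) : w ∈ code k (a * L + b) ↔ v ∈ code k L := by
  have h1 : form k w - (a * L + b) = a * (form k v - L) + modulus k * q := by rw [h]; ring
  rw [code, code, Set.mem_ofPred_eq, Set.mem_ofPred_eq, h1, dvd_add_left (dvd_mul_right _ _)]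
  exact ⟨ha.dvd_of_dvd_mul_left, fun h => h.mul_left a⟩

/-- The code is invariant under rotations up to translation: a quarter turn multiplies `form` by
`±(2k + 1)`, a square root of `-1` modulo `2k² + 2k + 1`. -/
lemma exists_code_cornerFrame (m n k L : ℤ) (C : Corner) :
    ∃ L', ∀ v, cornerFrame m n C v ∈ code k L' ↔ v ∈ code k L := by
  cases C with
  | southwest => exact ⟨L, fun v => Iff.rfl⟩
  | southeast =>
    refine ⟨_, fun v => mem_code_iff_of_form (a := -(2 * k + 1)) (b := k * (m - 1))
      (q := v.1 + v.2) ⟨2, 2 * k + 1, ?_⟩ ?_⟩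
    · simp only [modulus]; ring
    · simp only [cornerFrame, Equiv.coe_fn_mk, form, modulus]; ring
  | northwest =>
    refine ⟨_, fun v => mem_code_iff_of_form (a := 2 * k + 1) (b := (k + 1) * (n - 1))
      (q := -v.1 - v.2) ⟨2, -(2 * k + 1), ?_⟩ ?_⟩
    · simp only [modulus]; ring
    · simp only [cornerFrame, Equiv.coe_fn_mk, form, modulus]; ring
  | northeast =>
    refine ⟨_, fun v => mem_code_iff_of_form (a := -1) (b := (k + 1) * (m - 1) + k * (n - 1))
      (q := 0) ⟨0, -1, ?_⟩ ?_⟩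
    · ring
    · simp only [cornerFrame, Equiv.coe_fn_mk, form, modulus]; ring

lemma cornerSquare_subset_nbhd (k m n : ℕ) (C : Corner) : cornerSquare k m n C ⊆ nbhd k m n := by
  cases C <;> exact fun v hv => hv.1

lemma InDiamond.mem_nbhd {k m n : ℕ} {c v : ℤ × ℤ} (h : InDiamond k c v) (hv : v ∈ gridSet m n) :
    c ∈ nbhd k m n := by
  simp only [InDiamond] at h
  simp only [gridSet, nbhd, Set.mem_ofPred_eq] at hv ⊢
  omega

/-- The removal near the origin, transported to an arbitrary corner. -/
lemma exists_removable_corner {k m n : ℕ} (hk : 1 ≤ k) (hm : 2 * p k < m) (hn : 2 * p k < n)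
    (L : ℤ) (C : Corner) :
    ∃ s ∈ code k L, s ∈ cornerSquare k m n C ∧ ∃ σ : ℤ × ℤ → ℤ × ℤ,
      (∀ v, |(σ v).1 - v.1| ≤ 1 ∧ |(σ v).2 - v.2| ≤ 1) ∧
      ∀ v ∈ gridSet m n, ∀ c ∈ code k L, c ∈ cornerSquare k m n C → InDiamond k c v →
        ∃ c' ∈ code k L, c' ∈ cornerSquare k m n C ∧ c' ≠ s ∧ InDiamond k (σ c') v := by
  obtain ⟨L', hL'⟩ := exists_code_cornerFrame m n k L C
  obtain ⟨s, hs, hsS, σ, hσ, hrem⟩ := exists_removable (k := k) (by exact_mod_cast hk) L'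
  set e := cornerFrame m n C with he
  have hmem : ∀ w, e.symm w ∈ code k L ↔ w ∈ code k L' := fun w => by
    rw [← hL', e.apply_symm_apply]
  have hsq : ∀ w, e.symm w ∈ cornerSquare k m n C ↔ InSquare k w := fun w => by
    rw [mem_cornerSquare_iff hm hn, ← he, e.apply_symm_apply]
  refine ⟨e.symm s, (hmem s).2 hs, (hsq s).2 hsS, fun v => e.symm (σ (e v)), fun v => ?_,
    fun v hv c hc hcS hcv => ?_⟩
  · apply abs_sub_le_of_cornerFrame m n C
    rw [← he, e.apply_symm_apply]
    exact hσ (e v)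
  · obtain ⟨hv1, hv2⟩ := cornerFrame_nonneg hv C
    obtain ⟨c', hc', hc'S, hne, hc'v⟩ := hrem (e v) hv1 hv2 (e c) ((hL' c).2 hc)
      ((mem_cornerSquare_iff hm hn C c).1 hcS) ((inDiamond_cornerFrame m n C k c v).2 hcv)
    refine ⟨e.symm c', (hmem c').2 hc', (hsq c').2 hc'S, fun h => hne (e.symm.injective h), ?_⟩
    rw [← inDiamond_cornerFrame m n C, ← he, e.apply_symm_apply, e.apply_symm_apply]
    exact hc'v

end GridDomination

theorem mainTheorem2 (k m n : ℕ) (hk : 1 ≤ k)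
    (hm : 2 * GridDomination.p k < m) (hn : 2 * GridDomination.p k < n)
    (l : ZMod (GridDomination.p k)) :
    ∃ (s : GridDomination.Corner → ℤ × ℤ) (shift : ℤ × ℤ → ℤ × ℤ),
      Function.Injective s ∧
      (∀ c, s c ∈ GridDomination.domSet k m n l ∩ GridDomination.cornerSquare k m n c) ∧
      (∀ v, |(shift v).1 - v.1| ≤ 1 ∧ |(shift v).2 - v.2| ≤ 1) ∧
      (∀ v, (∀ c, v ∉ GridDomination.cornerSquare k m n c) → shift v = v) ∧
      GridDomination.DistDominates k
        (shift '' (GridDomination.domSet k m n l \ Set.range s))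
        (GridDomination.gridSet m n) := by
  classical
  open GridDomination in
  obtain ⟨L, rfl⟩ := ZMod.intCast_surjective l
  have hdom : ∀ v, v ∈ domSet k m n (L : ZMod (p k)) ↔ v ∈ code k L ∧ v ∈ nbhd k m n := fun v =>
    and_congr_left' (phi_eq_intCast_iff k L v)
  choose s hs hsS σ hσ hrem using exists_removable_corner hk hm hn L
  have huniq : ∀ {C D v}, v ∈ cornerSquare k m n C → v ∈ cornerSquare k m n D → C = D :=
    fun hC hD => corner_eq_of_mem_cornerSquare hm hn hC hD
  obtain ⟨shift, hshift, hfix⟩ : ∃ shift : ℤ × ℤ → ℤ × ℤ,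
      (∀ C, ∀ v ∈ cornerSquare k m n C, shift v = σ C v) ∧
      ∀ v, (∀ C, v ∉ cornerSquare k m n C) → shift v = v := by
    refine ⟨fun v => if h : ∃ C, v ∈ cornerSquare k m n C then σ h.choose v else v, ?_, ?_⟩
    · intro C v hv
      have h : ∃ C, v ∈ cornerSquare k m n C := ⟨C, hv⟩
      simp only [dif_pos h]
      rw [huniq h.choose_spec hv]
    · intro v hv
      exact dif_neg (not_exists.2 hv)
  refine ⟨s, shift, ?_, ?_, ?_, hfix, ?_⟩
  · intro C D h
    exact huniq (hsS C) (h ▸ hsS D)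
  · exact fun C => ⟨(hdom _).2 ⟨hs C, cornerSquare_subset_nbhd k m n C (hsS C)⟩, hsS C⟩
  · intro v
    by_cases h : ∃ C, v ∈ cornerSquare k m n C
    · obtain ⟨C, hC⟩ := h
      rw [hshift C v hC]
      exact hσ C v
    · rw [hfix v (not_exists.1 h)]
      simp
  · intro v hv
    suffices ∃ c ∈ code k L, c ∈ nbhd k m n ∧ c ∉ Set.range s ∧ InDiamond k (shift c) v by
      obtain ⟨c, hc, hcY, hcs, hcv⟩ := this
      exact ⟨shift c, ⟨c, ⟨(hdom c).2 ⟨hc, hcY⟩, hcs⟩, rfl⟩, hcv.edist_le⟩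
    obtain ⟨c, hc, hcv⟩ := exists_code_inDiamond (k := k) (by exact_mod_cast hk) L v
    by_cases h : ∃ C, c ∈ cornerSquare k m n C
    · obtain ⟨C, hC⟩ := h
      obtain ⟨c', hc', hc'S, hne, hc'v⟩ := hrem C v hv c hc hC hcv
      refine ⟨c', hc', cornerSquare_subset_nbhd k m n C hc'S, ?_, by rwa [hshift C c' hc'S]⟩
      rintro ⟨D, rfl⟩
      exact hne (congrArg s (huniq (hsS D) hc'S))
    · refine ⟨c, hc, hcv.mem_nbhd hv, ?_, by rwa [hfix c (not_exists.1 h)]⟩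
      rintro ⟨D, rfl⟩
      exact h ⟨D, hsS D⟩
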